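/- **Theorem 1 (Correctness).** Let $\mathcal G$ be a simple graph on the vertices $1,\dots,N$, measured in this order, and let $\mathcal A$ be a set of angles (mod $2\pi$) with $\mathcal A=\{(-1)^x\theta+z\pi : \theta\in\mathcal A,\ x,z\in\mathbb Z_2\}$. Let $I,O\subseteq\mathcal V$ be sets of input and output vertices, $\vec\alpha\in\mathcal A^N$, and let $(g,\succ)$ be a g-flow of the open graph $\mathcal G(I,O)$: $\succ$ is a strict partial order on $\mathcal V$ and $g:O^c\to P(I^c)$ is such that for every $i\in O^c$: (G1) $j\in g(i)$, $j\ne i$ imply $j\succ i$; (G2) $j\not\succ i$, $j\neq i$ imply $j\notin \mathrm{Odd}(g(i))$; (G3) $i\notin g(i)$ and $i\in\mathrm{Odd}(g(i))$, where $\mathrm{Odd}(K)$ is the set of vertices with an odd number of neighbours in $K$. Assume that the pattern is compatible with the order of measurements: for $i\in O^c$, every $j\in g(i)$ satisfies $i<j$, and every $j\in \mathrm{Odd}(g(i))\setminus(\{i\}\cup O)$ satisfies $i<j$. *Target computation.* Write $|\pm_\theta\rangle=(|0\rangle\pm e^{i\theta}|1\rangle)/\sqrt2$. The pattern implements $\{\rho_I,\hat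 U_A,\mathcal M\}$ if $\rho_I$ is the graph state of the subgraph induced on $I$; $\hat U_A$, a linear map from the qubits in $I$ to the qubits in $O$ with $\hat U_A^\dagger\hat U_A=1$, is a nonzero multiple of the positive branch, i.e. of the map that adds $|+\rangle$ on $I^c$, applies controlled-$Z$ along all edges not inside $I$, and applies $\bigotimes_{j\notin O}\langle +_{\alpha_j}|$; and $\mathcal M$ is the measurement of every output qubit $j\in O$ in the basis $|\pm_{\alpha_j}\rangle$ (outcome $0$ for $+$, $1$ for $-$). *Protocol CDBQC with honest Alice and Bob.* Bob prepares the graph state $|\mathcal G\rangle$. For $j=1,\dots,N$, Alice draws a uniform independent bit $r_j$ and sends $\alpha_j'=(-1)^{s^x_j}\alpha_j+(s^z_j+r_j)\pi \bmod 2\pi$; Bob measures qubit $j$ in the basis $|\pm_{\alpha'_j}\rangle$ and returns the outcome $b'_j$; Alice records $b_j=b'_j\oplus r_j$. Here $s^x_j=\bigoplus_{i\in O^c,\,j\in g(i)} b_i$, and $s^z_j$ is the sum modulo 2 of the $b_i$ with $i\in O^c\setminus\{j\}$ and $j\in\mathrm{Odd}(g(i))$ if $j\notin O$; if $j\in O$,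 it is the sum over an arbitrary fixed subset of those $i$ that also satisfy $i<j$, and the sum over the remaining $i$ is denoted $s^Z_{O,j}$. Alice outputs $\vec p\in\mathbb Z_2^{O}$ with $p_j=b_j\oplus s^Z_{O,j}$. Then the pattern implements some target computation, and for every target computation $\{\rho_I,\hat U_A,\mathcal M\}$ that it implements, the output $\vec p$ of the protocol has exactly the distribution $\mathcal M(\hat U_A\rho_I\hat U_A^\dagger)$ of the outcomes of the measurement $\mathcal M$ on $\hat U_A\rho_I\hat U_A^\dagger$. -/

import Mathlib

open scoped Matrix ENNReal

noncomputable section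

namespace CDBQC

/-! ### Open graphs and g-flow -/

open Classical in
/-- The odd neighbourhood `Odd(K)`: the vertices with an odd number of neighbours in `K`. -/
def oddNbhd {V : Type} [Fintype V] (G : SimpleGraph V) (K : Finset V) : Finset V :=
  Finset.univ.filter fun i => Odd (K.filter fun k => G.Adj i k).card

/-- `(g, ≺)` is a g-flow of the open graph `G(I, O)` (all measurements in the XY-plane). The
successor function `g : Oᶜ → P(Iᶜ)` is a total function of which only the values on `Oᶜ` matter;
`prec i j` means `i ≺ j`, that is `j ≻ i`, and is a strict partial order. -/
structure IsGFlow {V : Type} [Fintype V] (G : SimpleGraph V) (I O : Finset V)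
    (g : V → Finset V) (prec : V → V → Prop) : Prop where
  irrefl : ∀ i, ¬ prec i i
  trans : ∀ i j k, prec i j → prec j k → prec i k
  range : ∀ i, i ∉ O → ∀ j ∈ g i, j ∉ I
  g1 : ∀ i, i ∉ O → ∀ j ∈ g i, j ≠ i → prec i j
  g2 : ∀ i, i ∉ O → ∀ j, ¬ prec i j → i ≠ j → j ∉ oddNbhd G (g i)
  g3 : ∀ i, i ∉ O → i ∉ g i ∧ i ∈ oddNbhd G (g i)

/-- The corrections given by `g` can be carried out when the vertices `0, 1, …, N - 1` are
measured in this order: an X correction (which changes the measurement angle) is only caused by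
an earlier vertex, and so is a Z correction on a non-output vertex. Z corrections on output
vertices only flip the outcome and can be made after all measurements. In particular the
condition holds if the label order is a linear extension of the order of the g-flow. -/
structure IsOrderCompatible {N : ℕ} (G : SimpleGraph (Fin N)) (O : Finset (Fin N))
    (g : Fin N → Finset (Fin N)) : Prop where
  x_before : ∀ i, i ∉ O → ∀ j ∈ g i, i < j
  z_before : ∀ i, i ∉ O → ∀ j, j ∉ O → j ≠ i → j ∈ oddNbhd G (g i) → i < j

/-- The closure condition on the set of angles (angles are real numbers modulo `2π`). -/
def IsAngleDomain (A : Set Real.Angle) : Prop :=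
  A = {φ | ∃ θ ∈ A, ∃ x z : ZMod 2,
    φ = ((-1 : ℤ) ^ x.val) • θ + z.val • (Real.pi : Real.Angle)}

/-- The data of a measurement pattern on `N` qubits, measured in the order of their labels. -/
structure Pattern (N : ℕ) (A : Set Real.Angle) where
  /-- the graph -/
  G : SimpleGraph (Fin N)
  /-- the input vertices -/
  I : Finset (Fin N)
  /-- the output vertices -/
  O : Finset (Fin N)
  /-- the successor function of the g-flow -/
  g : Fin N → Finset (Fin N)
  /-- the canonical measurement angles (those of the positive branch) -/
  α : Fin N → A
  /-- bookkeeping choice: for an output vertex `j`, the earlier vertices whose Z correction on `j`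
  is put into the measurement angle of `j`; all other Z corrections on `j` are made in the
  classical post-processing -/
  zNow : Fin N → Finset (Fin N)

/-! ### Qubits -/

/-- The amplitude at `x` of `|±_θ⟩ = (|0⟩ ± e^{iθ}|1⟩) / √2`, with `b = 0` for `+`, `b = 1` for
`-`. -/
def xyKet (θ : Real.Angle) (b x : ZMod 2) : ℂ :=
  (if x = 0 then 1 else (-1) ^ b.val * (θ.toCircle : ℂ)) / (√2 : ℝ)

/-- The state space of a register of qubits labelled by `V`, in the computational basis. -/
abbrev Reg (V : Type) : Type := (V → ZMod 2) → ℂ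

/-- The diagonal entry at `x` of the controlled-`Z` gate on the qubits `i` and `j`. -/
def czSign {V : Type} (i j : V) (x : V → ZMod 2) : ℂ :=
  if x i = 1 ∧ x j = 1 then -1 else 1

open Classical in
/-- The graph state `∏_{ij ∈ E} CZ_{ij} |+⟩^{⊗V}`. -/
def graphState {V : Type} [Fintype V] [LinearOrder V] (G : SimpleGraph V) : Reg V := fun x =>
  (∏ i, ∏ j, if i < j ∧ G.Adj i j then czSign i j x else 1) *
    ((1 / (√2 : ℝ) : ℂ)) ^ Fintype.card V

open Classical in
/-- The (unnormalised) effect of measuring the qubit `j` in the basis `|±_θ⟩` with outcome `b`: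
the projector `|±_θ⟩⟨±_θ|_j` applied to `ψ`. -/
def project {V : Type} (j : V) (θ : Real.Angle) (b : ZMod 2) (ψ : Reg V) : Reg V := fun x =>
  xyKet θ b (x j) * ∑ t : ZMod 2, star (xyKet θ b t) * ψ (Function.update x j t)

open Classical in
/-- The squared norm of a vector. -/
def sqNorm {V : Type} [Fintype V] (ψ : Reg V) : ℝ≥0∞ := ∑ x, ENNReal.ofReal (‖ψ x‖ ^ 2)

/-- The Born rule: the outcome `b` of a measurement of the qubit `j` in the basis `|±_θ⟩` has
probability proportional to the squared norm of the projected vector. (The two weights add up to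
the squared norm of `ψ`; the value at `ψ = 0` is arbitrary and never occurs.) -/
def born {V : Type} [Fintype V] (ψ : Reg V) (j : V) (θ : Real.Angle) : PMF (ZMod 2) :=
  open Classical in
  if h : (∑' b, sqNorm (project j θ b ψ)) ≠ 0 then
    PMF.normalize (fun b => sqNorm (project j θ b ψ)) h
      (by
        rw [tsum_fintype]
        exact (ENNReal.sum_lt_top.2 fun b _ =>
          ENNReal.sum_lt_top.2 fun x _ => ENNReal.ofReal_lt_top).ne)
  else PMF.pure 0

/-! ### The protocol -/

namespace Pattern

variable {N : ℕ} {A : Set Real.Angle} (P : Pattern N A)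

/-- The dependency bit `s^x_j` as a function of the recorded outcomes `b_{<j}`. -/
def sx (b : Fin N → ZMod 2) (j : Fin N) : ZMod 2 :=
  ∑ i with i < j ∧ i ∉ P.O ∧ j ∈ P.g i, b i

/-- Whether the Z correction on `j` caused by `i` enters the measurement angle of `j`. -/
def ZInAngle (i j : Fin N) : Prop := i < j ∧ (j ∈ P.O → i ∈ P.zNow j)

open Classical in
/-- The dependency bit `s^z_j` as a function of the recorded outcomes `b_{<j}`. -/
def sz (b : Fin N → ZMod 2) (j : Fin N) : ZMod 2 :=
  ∑ i with i ∉ P.O ∧ i ≠ j ∧ j ∈ oddNbhd P.G (P.g i) ∧ P.ZInAngle i j, b i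

open Classical in
/-- The Z correction on the output vertex `j` left for the end of the protocol. -/
def szOut (b : Fin N → ZMod 2) (j : Fin N) : ZMod 2 :=
  ∑ i with i ∉ P.O ∧ i ≠ j ∧ j ∈ oddNbhd P.G (P.g i) ∧ ¬ P.ZInAngle i j, b i

/-- The angle `α'_j = (-1)^{s^x_j} α_j + (s^z_j + r_j) π` (mod `2π`) that Alice sends. -/
def sentAngle (b : Fin N → ZMod 2) (r : ZMod 2) (j : Fin N) : Real.Angle :=
  ((-1 : ℤ) ^ (P.sx b j).val) • (P.α j : Real.Angle) +
    (P.sz b j + r).val • (Real.pi : Real.Angle)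

/-- Alice's record of the decoded outcomes (`0` where nothing is recorded yet), and a vector
spanning the current state of Bob's qubits. -/
abbrev RunState (N : ℕ) : Type := (Fin N → ZMod 2) × Reg (Fin N)

/-- Round `j`: Alice draws the uniform bit `r_j` and sends the angle `α'_j`; Bob measures qubit
`j` and returns the outcome `b'_j`; Alice records `b_j = b'_j ⊕ r_j`. -/
def round (s : RunState N) (j : Fin N) : PMF (RunState N) :=
  (PMF.uniformOfFintype (ZMod 2)).bind fun r =>
    (born s.2 j (P.sentAngle s.1 r j)).bind fun b' =>
      PMF.pure (Function.update s.1 j (b' + r), project j (P.sentAngle s.1 r j) b' s.2)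

/-- The rounds of the protocol for a list of vertices. -/
def rounds : List (Fin N) → RunState N → PMF (RunState N)
  | [], s => PMF.pure s
  | j :: l, s => (P.round s j).bind (rounds l)

/-- The output string `p = p^C ⊕ s^Z_O` that Alice computes from the outcomes. -/
def output (b : Fin N → ZMod 2) : P.O → ZMod 2 := fun j => b j + P.szOut b j

/-- The law of the output of the protocol with honest Alice and Bob: Bob prepares the graph state,
the qubits are measured in the order `0, 1, …, N - 1`, and Alice post-processes. -/
def honestOutput : PMF (P.O → ZMod 2) :=
  (P.rounds (List.finRange N) (0, graphState P.G)).map fun s => P.output s.1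

/-! ### The target computation -/

open Classical in
/-- The map that adds to the input register the remaining qubits in the state `|+⟩` and applies
`CZ` along all edges that do not lie inside `I`. -/
def prepare : Matrix (Fin N → ZMod 2) (P.I → ZMod 2) ℂ := fun x u =>
  if (fun i : P.I => x i) = u then
    (∏ i, ∏ j, if i < j ∧ P.G.Adj i j ∧ ¬ (i ∈ P.I ∧ j ∈ P.I) then czSign i j x else 1) *
      ((1 / (√2 : ℝ) : ℂ)) ^ (P.I)ᶜ.card
  else 0

open Classical in
/-- The map `⊗_{j ∉ O} ⟨+_{α_j}|_j` onto the output register. -/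
def projectPlus : Matrix (P.O → ZMod 2) (Fin N → ZMod 2) ℂ := fun y x =>
  if (fun j : P.O => x j) = y then ∏ j ∈ (P.O)ᶜ, star (xyKet (P.α j) 0 (x j)) else 0

/-- The positive branch of the pattern, from the input register to the output register. -/
def positiveBranch : Matrix (P.O → ZMod 2) (P.I → ZMod 2) ℂ := P.projectPlus * P.prepare

/-- The product vector `⊗_{j ∈ O} |±_{α_j}⟩` with signs given by `p`. -/
def outKet (p : P.O → ZMod 2) : Reg P.O := fun y =>
  ∏ j : P.O, xyKet (P.α j) (p j) (y j)

end Pattern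

/-- A computation with an input register labelled by `I` and an output register labelled by `O`:
a density matrix, a matrix (the unitary embedding), and the measurement operators on the output,
indexed by the outcome string. -/
structure Computation (I O : Type) [Fintype I] [Fintype O] where
  /-- the input state `ρ_I` -/
  ρ : Matrix (I → ZMod 2) (I → ZMod 2) ℂ
  /-- the unitary embedding `U_A` -/
  U : Matrix (O → ZMod 2) (I → ZMod 2) ℂ
  /-- the final measurement `𝓜` -/
  M : (O → ZMod 2) → Matrix (O → ZMod 2) (O → ZMod 2) ℂ

open Classical in
/-- The weight of the outcome `p` in `𝓜(U ρ U†)`. -/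
def Computation.prob {I O : Type} [Fintype I] [Fintype O] (Δ : Computation I O)
    (p : O → ZMod 2) : ℂ :=
  (Δ.M p * (Δ.U * Δ.ρ * Δ.Uᴴ)).trace

open Classical in
/-- The pattern `P` describes the target computation `Δ`: the input is the graph state on the
input vertices, the positive branch is the unitary embedding `U` up to a nonzero scalar, and the
final measurement is that of each output qubit `j` in the basis `|±_{α_j}⟩`. -/
structure Pattern.Implements {N : ℕ} {A : Set Real.Angle} (P : Pattern N A)
    (Δ : Computation P.I P.O) : Prop where
  input : Δ.ρ = Matrix.vecMulVec
    (graphState (P.G.comap (Subtype.val : P.I → Fin N)))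
    (star (graphState (P.G.comap (Subtype.val : P.I → Fin N))))
  isometry : Δ.Uᴴ * Δ.U = 1
  branch : ∃ c : ℂ, c ≠ 0 ∧ P.positiveBranch = c • Δ.U
  measurement : ∀ p, Δ.M p = Matrix.vecMulVec (P.outKet p) (star (P.outKet p))

end CDBQC

end

/-!
The vector onto which the qubit `j` is projected in the protocol does not involve the random bit
`r_j`: shifting the angle by `r_j π` and adding `r_j` to the outcome cancel (`xyKet_sentAngle`). So
the recorded outcomes `b` have probability `|⟨v_b|𝒢⟩|²`, where `v_b` is a product vector whose
factors depend on the earlier outcomes (`sqNorm_mul_rounds`, `outputLaw_apply`).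

The dependencies of `v_b` on `b` are those of the operator `X^t Z^z`, with `t` the sum of the
indicators of the sets `g(i)` over the non-output vertices `i` with `b_i = 1`, and `z` the sum of
the indicators of `Odd(g(i))` (`sum_adj_sx`). As `t` vanishes on the input, this operator
stabilizes up to a sign every state that arises by preparing the pattern on an arbitrary input
(`prepare_mulVec_add`). Moving it onto the state removes all dependencies except, on the output
vertices, the sign given by the output string `p` (`outcome_add_corrections`). Hence
`|⟨v_b|ψ⟩|² = |⟨w_p|ψ⟩|²`, with `w_p` the product of `|+_{α_j}⟩` off the output and of `|±_{α_j}⟩`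
with signs `p` on it (`norm_overlap_branchKet`). Each `p` comes from the same number `K` of strings
`b` (`card_output_eq`), so the output law is `K |⟨w_p|ψ⟩|² = K |⟨p|Lφ⟩|²` for `ψ` prepared from the
input `φ`, where `L` is the positive branch.

This holds for every unit vector `φ`, not only for the graph state on the input. Since the
probabilities sum to `1`, it follows that `K ‖Lφ‖² = 1` and by polarization that `√K L` is an
isometry (`fiberCard_smul_positiveBranch`). This gives a target computation, and it shows that any
isometry `U` with `L = c U` has `K |c|² = 1`, which turns the output law into `|⟨p|Uφ⟩|²`.
-/

noncomputable section

namespace CDBQC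

/-! ### The measurement basis of one qubit -/

/-- The character `a ↦ (-1)ᵃ` of `ℤ/2`. -/
def zsign (a : ZMod 2) : ℂ := (-1) ^ a.val

lemma zmod_two_cases (a : ZMod 2) : a = 0 ∨ a = 1 := by
  revert a; decide

lemma zmod_two_one_add_one : (1 + 1 : ZMod 2) = 0 := rfl

lemma zmod_two_val_one : (1 : ZMod 2).val = 1 := rfl

lemma zsign_zero : zsign 0 = 1 := by simp [zsign]

lemma zsign_one : zsign 1 = -1 := by simp [zsign, zmod_two_val_one]

lemma zsign_add (a b : ZMod 2) : zsign (a + b) = zsign a * zsign b := by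
  rcases zmod_two_cases a with rfl | rfl <;> rcases zmod_two_cases b with rfl | rfl <;>
    simp [zsign_zero, zsign_one, zmod_two_one_add_one]

lemma zsign_sum {ι : Type*} (s : Finset ι) (f : ι → ZMod 2) :
    zsign (∑ i ∈ s, f i) = ∏ i ∈ s, zsign (f i) := by
  classical
  induction s using Finset.induction_on with
  | empty => simp [zsign_zero]
  | insert a s ha ih => rw [Finset.sum_insert ha, Finset.prod_insert ha, zsign_add, ih]

lemma norm_zsign (a : ZMod 2) : ‖zsign a‖ = 1 := by simp [zsign]

lemma star_zsign (a : ZMod 2) : star (zsign a) = zsign a := by simp [zsign]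

lemma czSign_eq_zsign {V : Type} (i j : V) (x : V → ZMod 2) :
    czSign i j x = zsign (x i * x j) := by
  unfold czSign
  rcases zmod_two_cases (x i) with h | h <;> rcases zmod_two_cases (x j) with h' | h' <;>
    simp [h, h', zsign_zero, zsign_one]

lemma sum_zmod_two {M : Type*} [AddCommMonoid M] (f : ZMod 2 → M) : ∑ t, f t = f 0 + f 1 :=
  Fin.sum_univ_two f

lemma norm_xyKet_sq (θ : Real.Angle) (b x : ZMod 2) : ‖xyKet θ b x‖ ^ 2 = 1 / 2 := by
  unfold xyKet
  split_ifs <;> simp [Circle.norm_coe]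

lemma xyKet_eq (θ : Real.Angle) (b x : ZMod 2) :
    xyKet θ b x = zsign (b * x) * (θ.toCircle : ℂ) ^ x.val / (√2 : ℝ) := by
  rcases zmod_two_cases b with rfl | rfl <;> rcases zmod_two_cases x with rfl | rfl <;>
    simp [xyKet, zsign_zero, zsign_one, zmod_two_val_one]

lemma xyKet_add (θ : Real.Angle) (b z x : ZMod 2) :
    xyKet θ (b + z) x = zsign (z * x) * xyKet θ b x := by
  rw [xyKet_eq, xyKet_eq, add_mul, zsign_add]
  ring

/-- Shifting the angle by `rπ` exchanges the basis vectors `|±_θ⟩` according to `r`. -/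
lemma xyKet_add_pi (θ : Real.Angle) (b r : ZMod 2) :
    xyKet (θ + r.val • (Real.pi : Real.Angle)) b = xyKet θ (b + r) := by
  funext x
  rw [xyKet_add, xyKet_eq, xyKet_eq]
  have h : (((θ + r.val • (Real.pi : Real.Angle)).toCircle : Circle) : ℂ)
      = zsign r * (θ.toCircle : ℂ) := by
    rcases zmod_two_cases r with rfl | rfl
    · simp [zsign]
    · simp [zsign_one, zmod_two_val_one, Real.Angle.toCircle_add]
  rw [h]
  rcases zmod_two_cases x with rfl | rfl
  · simp [zsign_zero]
  · simp [zmod_two_val_one]; ring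

/-- Negating the angle is, up to a phase, a bit flip of the vector `|±_θ⟩`. -/
lemma exists_xyKet_neg (θ : Real.Angle) (b t : ZMod 2) :
    ∃ c : ℂ, ‖c‖ = 1 ∧
      ∀ x, xyKet (((-1 : ℤ) ^ t.val) • θ) b x = c * xyKet θ b (x + t) := by
  rcases zmod_two_cases t with rfl | rfl
  · exact ⟨1, by simp, fun x => by simp⟩
  · refine ⟨zsign b * ((-θ).toCircle : ℂ), by simp [norm_zsign, Circle.norm_coe], fun x => ?_⟩
    have h : ((-θ).toCircle : ℂ) * (θ.toCircle : ℂ) = 1 := by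
      rw [← Circle.coe_mul, ← Real.Angle.toCircle_add]; simp
    have hb : zsign b * zsign b = 1 := by
      rw [← zsign_add, CharTwo.add_self_eq_zero, zsign_zero]
    rw [xyKet_eq, xyKet_eq]
    rcases zmod_two_cases x with rfl | rfl
    · simp only [zmod_two_val_one, ZMod.val_zero, zero_add, mul_one, mul_zero, zsign_zero, pow_zero,
        pow_one]
      linear_combination
        (-(((-θ).toCircle : ℂ) * (θ.toCircle : ℂ)) / ((√2 : ℝ) : ℂ)) * hb - h / ((√2 : ℝ) : ℂ)
    · simp [zmod_two_one_add_one, zmod_two_val_one, zsign_zero, div_eq_mul_inv]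

lemma sum_xyKet_mul_star (θ : Real.Angle) (x y : ZMod 2) :
    ∑ b, xyKet θ b x * star (xyKet θ b y) = if x = y then 1 else 0 := by
  split_ifs with h
  · subst h
    have (b : ZMod 2) : xyKet θ b x * star (xyKet θ b x) = 1 / 2 := by
      have := Complex.mul_conj' (xyKet θ b x)
      rw [← Complex.ofReal_pow, norm_xyKet_sq] at this
      simpa using this
    simp only [this, sum_zmod_two]; norm_num
  · have hxy : zsign x * zsign y = -1 := by
      rcases zmod_two_cases x with rfl | rfl <;> rcases zmod_two_cases y with rfl | rfl <;>
        simp_all [zsign_zero, zsign_one]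
    have h1 (z : ZMod 2) : xyKet θ 1 z = zsign z * xyKet θ 0 z := by
      simpa using xyKet_add θ 0 1 z
    rw [sum_zmod_two, h1, h1, star_mul', star_zsign]
    linear_combination (xyKet θ 0 x * star (xyKet θ 0 y)) * hxy

/-! ### Projections onto product vectors and the Born rule -/

/-- Parseval's identity for a family of vectors `k b` that resolves the identity. -/
lemma sum_norm_sum_star_mul_sq {ι κ : Type*} [Fintype ι] [Fintype κ] [DecidableEq κ]
    (k : ι → κ → ℂ) (hk : ∀ x y, ∑ b, k b x * star (k b y) = if x = y then 1 else 0) (f : κ → ℂ) :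
    ∑ b, ‖∑ t, star (k b t) * f t‖ ^ 2 = ∑ t, ‖f t‖ ^ 2 := by
  have h : ∑ b, (∑ t, star (k b t) * f t) * star (∑ t, star (k b t) * f t) =
      ∑ t, f t * star (f t) := by
    have (b : ι) : (∑ t, star (k b t) * f t) * star (∑ t, star (k b t) * f t) =
        ∑ s, ∑ t, (f t * star (f s)) * (k b s * star (k b t)) := by
      rw [star_sum, mul_comm, Finset.sum_mul_sum]
      refine Finset.sum_congr rfl fun s _ => Finset.sum_congr rfl fun t _ => ?_
      simp only [star_mul', star_star]; ring
    simp only [this]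
    rw [Finset.sum_comm]
    refine Finset.sum_congr rfl fun s _ => ?_
    rw [Finset.sum_comm]
    simp only [← Finset.mul_sum, hk]
    simp
  simp only [Complex.star_def, Complex.mul_conj', ← Complex.ofReal_pow, ← Complex.ofReal_sum] at h
  simpa using Complex.ofReal_injective h

section Register

variable {V : Type} [DecidableEq V]

/-- The operator `|v⟩⟨v|` acting on the qubit `j`. -/
def projKet (j : V) (v : ZMod 2 → ℂ) (ψ : Reg V) : Reg V := fun x =>
  v (x j) * ∑ t, star (v t) * ψ (Function.update x j t)

lemma project_eq_projKet (j : V) (θ : Real.Angle) (b : ZMod 2) (ψ : Reg V) :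
    project j θ b ψ = projKet j (xyKet θ b) ψ := by
  funext x
  unfold project projKet
  congr!

/-- The operators `|v_j⟩⟨v_j|` for the qubits of a list, applied one after the other. -/
def projList (v : V → ZMod 2 → ℂ) : List V → Reg V → Reg V
  | [], ψ => ψ
  | j :: l, ψ => projList v l (projKet j (v j) ψ)

variable [Fintype V]

/-- `⟨v|ψ⟩` for the product vector `⊗_j v_j`. -/
def overlap (v : V → ZMod 2 → ℂ) (ψ : Reg V) : ℂ := ∑ x, (∏ j, star (v j (x j))) * ψ x

lemma sqNorm_eq_ofReal (ψ : Reg V) : sqNorm ψ = ENNReal.ofReal (∑ x, ‖ψ x‖ ^ 2) := by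
  rw [ENNReal.ofReal_sum_of_nonneg fun x _ => by positivity]
  unfold sqNorm
  congr!

/-- `(x, t) ↦ (x with x_j replaced by t, x_j)` is an involution. -/
lemma sum_update_swap {M : Type*} [AddCommMonoid M] (j : V)
    (F : (V → ZMod 2) → (V → ZMod 2) → M) :
    ∑ x, ∑ t, F x (Function.update x j t) = ∑ x, ∑ t, F (Function.update x j t) x := by
  rw [← Fintype.sum_prod_type', ← Fintype.sum_prod_type']
  let f : (V → ZMod 2) × ZMod 2 → (V → ZMod 2) × ZMod 2 :=
    fun q => (Function.update q.1 j q.2, q.1 j)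
  have hf : Function.Involutive f := fun q => by simp [f]
  refine Fintype.sum_equiv hf.toPerm _ _ fun q => ?_
  simp [f]

lemma sum_sum_update {M : Type*} [AddCommMonoid M] (j : V) (F : (V → ZMod 2) → M) :
    ∑ x, ∑ t, F (Function.update x j t) = 2 • ∑ x, F x := by
  rw [sum_update_swap j fun _ y => F y]
  simp [Finset.sum_nsmul]

lemma projList_apply (v : V → ZMod 2 → ℂ) (l : List V) (hl : l.Nodup) (ψ : Reg V)
    (x : V → ZMod 2) :
    projList v l ψ x = (∏ j ∈ l.toFinset, v j (x j)) *
      ∑ y, if (∀ i, i ∉ l → y i = x i) then (∏ j ∈ l.toFinset, star (v j (y j))) * ψ y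
        else 0 := by
  induction l generalizing ψ with
  | nil =>
    have (y : V → ZMod 2) : (∀ i, y i = x i) ↔ y = x := funext_iff.symm
    simp [projList, this]
  | cons j l ih =>
    obtain ⟨hj, hl⟩ := List.nodup_cons.1 hl
    have hj' : j ∉ l.toFinset := by simpa using hj
    rw [projList, ih hl, List.toFinset_cons, Finset.prod_insert hj', mul_comm (v j (x j)),
      mul_assoc]
    congr 1
    let F : (V → ZMod 2) → (V → ZMod 2) → ℂ := fun y z =>
      if (∀ i, i ∉ l → y i = x i) then
        (∏ k ∈ l.toFinset, star (v k (y k))) * (v j (x j) * (star (v j (z j)) * ψ z)) else 0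
    have h1 (y : V → ZMod 2) :
        (if (∀ i, i ∉ l → y i = x i) then
          (∏ k ∈ l.toFinset, star (v k (y k))) * projKet j (v j) ψ y else 0) =
        ∑ t, F y (Function.update y j t) := by
      by_cases h : ∀ i, i ∉ l → y i = x i
      · simp only [F, if_pos h, projKet, h j hj, Finset.mul_sum, Function.update_self]
      · simp only [F, if_neg h, Finset.sum_const_zero]
    simp only [h1]
    rw [sum_update_swap, Finset.mul_sum]
    refine Finset.sum_congr rfl fun y _ => ?_
    rw [Finset.sum_eq_single (x j)]
    · have h2 : (∀ i, i ∉ l → Function.update y j (x j) i = x i) ↔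
          ∀ i, i ∉ j :: l → y i = x i := by
        constructor
        · intro h i hi
          rw [List.mem_cons, not_or] at hi
          simpa [hi.1] using h i hi.2
        · intro h i hi
          by_cases hij : i = j
          · subst hij; simp
          · simpa [hij] using h i (by simp [hij, hi])
      have h3 : ∏ k ∈ l.toFinset, star (v k (Function.update y j (x j) k)) =
          ∏ k ∈ l.toFinset, star (v k (y k)) := by
        refine Finset.prod_congr rfl fun k hk => ?_
        have hkj : k ≠ j := by rintro rfl; exact hj' hk
        rw [Function.update_of_ne hkj]
      simp only [F, h2, h3, Finset.prod_insert hj', mul_ite, mul_zero]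
      refine if_congr Iff.rfl ?_ rfl
      ring
    · intro t _ ht
      refine if_neg fun h => ht ?_
      simpa using h j hj
    · simp

/-- A product of unit vectors is a unit vector. -/
lemma sum_norm_prod_sq (v : V → ZMod 2 → ℂ) (hv : ∀ j, ∑ t, ‖v j t‖ ^ 2 = 1) :
    ∑ x : V → ZMod 2, ‖∏ j, v j (x j)‖ ^ 2 = 1 := by
  simp only [norm_prod, ← Finset.prod_pow]
  rw [← Fintype.piFinset_univ, ← Finset.prod_univ_sum (fun _ => Finset.univ)
    (fun j t => ‖v j t‖ ^ 2)]
  simp [hv]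

/-- Projecting every qubit onto a unit vector leaves the squared overlap with the product of these
vectors as the squared norm. -/
lemma sqNorm_projList (v : V → ZMod 2 → ℂ) (hv : ∀ j, ∑ t, ‖v j t‖ ^ 2 = 1) (l : List V)
    (hl : l.Nodup) (hmem : ∀ j, j ∈ l) (ψ : Reg V) :
    sqNorm (projList v l ψ) = ENNReal.ofReal (‖overlap v ψ‖ ^ 2) := by
  have huniv : l.toFinset = Finset.univ := by ext; simp [hmem]
  have h (x : V → ZMod 2) : projList v l ψ x = (∏ j, v j (x j)) * overlap v ψ := by
    rw [projList_apply v l hl, huniv]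
    simp [hmem, overlap]
  rw [sqNorm_eq_ofReal]
  simp only [h, norm_mul, mul_pow]
  rw [← Finset.sum_mul, sum_norm_prod_sq v hv, one_mul]

lemma sum_norm_xyKet_sq (θ : Real.Angle) (b : ZMod 2) : ∑ t, ‖xyKet θ b t‖ ^ 2 = 1 := by
  simp only [norm_xyKet_sq, sum_zmod_two]; norm_num

lemma sum_sqNorm_project (ψ : Reg V) (j : V) (θ : Real.Angle) :
    ∑ b, sqNorm (project j θ b ψ) = sqNorm ψ := by
  simp only [project_eq_projKet, sqNorm_eq_ofReal]
  rw [← ENNReal.ofReal_sum_of_nonneg fun b _ => by positivity]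
  congr 1
  simp only [projKet, norm_mul, mul_pow, norm_xyKet_sq]
  rw [Finset.sum_comm]
  simp only [← Finset.mul_sum,
    sum_norm_sum_star_mul_sq (xyKet θ) (sum_xyKet_mul_star θ) fun t => ψ (Function.update _ j t)]
  rw [sum_sum_update j fun x => ‖ψ x‖ ^ 2]
  simp

lemma sqNorm_ne_top (ψ : Reg V) : sqNorm ψ ≠ ∞ := by
  rw [sqNorm_eq_ofReal]; exact ENNReal.ofReal_ne_top

/-- The Born rule without division. -/
lemma sqNorm_mul_born (ψ : Reg V) (j : V) (θ : Real.Angle) (b : ZMod 2) :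
    sqNorm ψ * born ψ j θ b = sqNorm (project j θ b ψ) := by
  have hsum := sum_sqNorm_project ψ j θ
  unfold born
  split_ifs with h
  · rw [PMF.normalize_apply, tsum_fintype, hsum, mul_comm, mul_assoc]
    rw [tsum_fintype, hsum] at h
    rw [ENNReal.inv_mul_cancel h (sqNorm_ne_top ψ), mul_one]
  · rw [not_not, tsum_fintype] at h
    rw [← hsum, h, zero_mul]
    exact ((Finset.sum_eq_zero_iff.1 h) b (Finset.mem_univ b)).symm

end Register

namespace Pattern

/-! ### The law of the recorded outcomes -/

variable {N : ℕ} {A : Set Real.Angle} (P : Pattern N A)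

lemma sx_congr {b b' : Fin N → ZMod 2} {j : Fin N} (h : ∀ i < j, b i = b' i) :
    P.sx b j = P.sx b' j :=
  Finset.sum_congr rfl fun i hi => h i (Finset.mem_filter.1 hi).2.1

lemma sz_congr {b b' : Fin N → ZMod 2} {j : Fin N} (h : ∀ i < j, b i = b' i) :
    P.sz b j = P.sz b' j := by
  classical
  exact Finset.sum_congr rfl fun i hi => h i (Finset.mem_filter.1 hi).2.2.2.2.1

/-- The vector onto which the qubit `j` is projected when the recorded outcomes are `b`. The bit
`r_j` drops out of it: it changes the angle and the reported outcome in a compensating way. -/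
def branchKet (b : Fin N → ZMod 2) (j : Fin N) : ZMod 2 → ℂ :=
  xyKet (((-1 : ℤ) ^ (P.sx b j).val) • (P.α j : Real.Angle)) (b j + P.sz b j)

lemma xyKet_sentAngle (b : Fin N → ZMod 2) (r : ZMod 2) (j : Fin N) :
    xyKet (P.sentAngle b r j) (b j + r) = P.branchKet b j := by
  rw [sentAngle, xyKet_add_pi, branchKet]
  congr 1
  calc b j + r + (P.sz b j + r) = b j + P.sz b j + (r + r) := by ring
    _ = _ := by rw [CharTwo.add_self_eq_zero, add_zero]

lemma sentAngle_congr {b b' : Fin N → ZMod 2} (r : ZMod 2) {j : Fin N}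
    (h : ∀ i < j, b i = b' i) : P.sentAngle b r j = P.sentAngle b' r j := by
  rw [sentAngle, sentAngle, P.sx_congr h, P.sz_congr h]

/-- The law of the recorded outcomes after measuring the vertices of an increasing list, up to the
squared norm of the initial state. -/
lemma sqNorm_mul_rounds (l : List (Fin N)) (hl : l.Pairwise (· < ·)) (b : Fin N → ZMod 2)
    (ψ : Reg (Fin N)) (b₁ : Fin N → ZMod 2) :
    sqNorm ψ * ((P.rounds l (b, ψ)).map Prod.fst) b₁ =
      if (∀ i, i ∉ l → b₁ i = b i) then sqNorm (projList (P.branchKet b₁) l ψ) else 0 := by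
  induction l generalizing b ψ with
  | nil =>
    have : (∀ i, b₁ i = b i) ↔ b₁ = b := funext_iff.symm
    simp [rounds, projList, PMF.pure_map, PMF.pure_apply, this]
  | cons j l ih =>
    obtain ⟨hj, hl⟩ := List.pairwise_cons.1 hl
    have hjl : j ∉ l := fun h => (hj j h).false
    have hcond (c : ZMod 2) : (∀ i, i ∉ l → b₁ i = Function.update b j c i) ↔
        (∀ i, i ∉ j :: l → b₁ i = b i) ∧ b₁ j = c := by
      constructor
      · intro h
        refine ⟨fun i hi => ?_, by simpa using h j hjl⟩
        rw [List.mem_cons, not_or] at hi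
        simpa [hi.1] using h i hi.2
      · rintro ⟨h, hc⟩ i hi
        by_cases hij : i = j
        · subst hij; simpa using hc
        · simpa [hij] using h i (by simp [hij, hi])
    have hstep : sqNorm ψ * ((P.rounds (j :: l) (b, ψ)).map Prod.fst) b₁ =
        ∑ r : ZMod 2, (2 : ℝ≥0∞)⁻¹ * ∑ b', sqNorm (project j (P.sentAngle b r j) b' ψ) *
          ((P.rounds l (Function.update b j (b' + r),
            project j (P.sentAngle b r j) b' ψ)).map Prod.fst) b₁ := by
      simp only [rounds, round, PMF.map_bind, PMF.bind_bind, PMF.pure_bind]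
      rw [PMF.bind_apply, tsum_fintype, Finset.mul_sum]
      refine Finset.sum_congr rfl fun r _ => ?_
      rw [PMF.bind_apply, tsum_fintype, PMF.uniformOfFintype_apply, mul_left_comm,
        Finset.mul_sum]
      simp only [← mul_assoc, sqNorm_mul_born]
      simp [ZMod.card]
    rw [hstep]
    simp only [ih hl, hcond]
    by_cases h : ∀ i, i ∉ j :: l → b₁ i = b i
    · have hlt : ∀ i < j, b i = b₁ i := fun i hi => by
        refine (h i ?_).symm
        rw [List.mem_cons, not_or]
        exact ⟨hi.ne, fun hil => lt_asymm hi (hj i hil)⟩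
      have hr (r : ZMod 2) : (∑ b', if (∀ i, i ∉ j :: l → b₁ i = b i) ∧ b₁ j = b' + r then
          sqNorm (projList (P.branchKet b₁) l (project j (P.sentAngle b r j) b' ψ)) else 0) =
          sqNorm (projList (P.branchKet b₁) (j :: l) ψ) := by
        rw [Finset.sum_eq_single (b₁ j + r)]
        · rw [if_pos ⟨h, by rw [add_assoc, CharTwo.add_self_eq_zero, add_zero]⟩,
            project_eq_projKet, P.sentAngle_congr r hlt, xyKet_sentAngle, projList]
        · intro c _ hc
          refine if_neg fun hh => hc ?_
          rw [hh.2, add_assoc, CharTwo.add_self_eq_zero, add_zero]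
        · simp
      simp only [hr, if_pos h, sum_zmod_two]
      rw [← add_mul, ENNReal.inv_two_add_inv_two, one_mul]
    · simp only [h, false_and, if_false, Finset.sum_const_zero, mul_zero]

/-- The law of the output of the protocol run on the initial state `ψ`. -/
def outputLaw (ψ : Reg (Fin N)) : PMF (P.O → ZMod 2) :=
  (P.rounds (List.finRange N) (0, ψ)).map fun s => P.output s.1

/-- For a normalised initial state the probability of an output is the sum, over the outcome strings
that lead to it, of the squared overlaps with the corresponding product vectors. -/
lemma outputLaw_apply (ψ : Reg (Fin N)) (hψ : sqNorm ψ = 1) (p : P.O → ZMod 2) :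
    P.outputLaw ψ p = ∑ b with P.output b = p,
      ENNReal.ofReal (‖overlap (P.branchKet b) ψ‖ ^ 2) := by
  have hlaw (b : Fin N → ZMod 2) :
      ((P.rounds (List.finRange N) (0, ψ)).map Prod.fst) b =
        ENNReal.ofReal (‖overlap (P.branchKet b) ψ‖ ^ 2) := by
    have := P.sqNorm_mul_rounds (List.finRange N) (List.pairwise_lt_finRange N) 0 ψ b
    rw [hψ, one_mul] at this
    rw [this, if_pos (by simp), sqNorm_projList (P.branchKet b)
      (fun j => sum_norm_xyKet_sq _ _) _
      (List.nodup_finRange N) List.mem_finRange]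
  have hcomp : P.outputLaw ψ =
      ((P.rounds (List.finRange N) (0, ψ)).map Prod.fst).map P.output := by
    rw [PMF.map_comp]; rfl
  rw [hcomp, PMF.map_apply, tsum_fintype, Finset.sum_filter]
  refine Finset.sum_congr rfl fun b _ => ?_
  rw [hlaw]
  simp only [eq_comm (a := p)]

end Pattern

namespace Pattern

variable {N : ℕ} {A : Set Real.Angle} (P : Pattern N A)

/-! ### Stabilizers of the prepared state -/

open Classical in
/-- The quadratic form `∑ x_i x_j` over the edges `ij` not inside `I`: the controlled-`Z` gates of
`prepare` act on the basis vector `x` as `(-1)` to this power. -/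
def edgeForm (x : Fin N → ZMod 2) : ZMod 2 :=
  ∑ i, ∑ j, if i < j ∧ P.G.Adj i j ∧ ¬ (i ∈ P.I ∧ j ∈ P.I) then x i * x j else 0

lemma prepare_mulVec (φ : Reg P.I) (x : Fin N → ZMod 2) :
    (P.prepare *ᵥ φ) x =
      zsign (P.edgeForm x) * ((1 / (√2 : ℝ) : ℂ)) ^ (P.I)ᶜ.card * φ fun i => x i := by
  classical
  rw [Matrix.mulVec, dotProduct, Finset.sum_eq_single fun i : P.I => x i]
  · simp only [prepare, if_pos, edgeForm, zsign_sum, czSign_eq_zsign, apply_ite zsign, zsign_zero]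
  · intro u _ hu
    rw [prepare, if_neg (Ne.symm hu), zero_mul]
  · intro h
    exact absurd (Finset.mem_univ _) h

open Classical in
/-- The polar form of `edgeForm`, for a shift that is supported off `I`. -/
lemma edgeForm_add (x t : Fin N → ZMod 2) (ht : ∀ i ∈ P.I, t i = 0) :
    P.edgeForm (x + t) = P.edgeForm x + P.edgeForm t +
      ∑ i, x i * ∑ j, if P.G.Adj i j then t j else 0 := by
  let K (i j : Fin N) : ZMod 2 := if i < j ∧ P.G.Adj i j ∧ ¬ (i ∈ P.I ∧ j ∈ P.I) then 1 else 0
  have hK (y : Fin N → ZMod 2) : P.edgeForm y = ∑ i, ∑ j, K i j * (y i * y j) := by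
    simp [edgeForm, K]
  have hKt (i j : Fin N) : (K i j + K j i) * (x i * t j) =
      x i * if P.G.Adj i j then t j else 0 := by
    by_cases hj : j ∈ P.I
    · simp [ht j hj]
    · by_cases hadj : P.G.Adj i j
      · rcases lt_or_gt_of_ne hadj.ne with h | h
        · simp [K, hj, hadj, h, h.not_gt]
        · simp [K, hj, hadj.symm, hadj, h, h.not_gt]
      · have hadj' : ¬ P.G.Adj j i := fun h => hadj h.symm
        simp [K, hadj, hadj']
  simp only [Finset.mul_sum, ← hKt, add_mul, Finset.sum_add_distrib]
  rw [Finset.sum_comm (f := fun i j => K j i * (x i * t j)), hK, hK, hK]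
  simp only [← Finset.sum_add_distrib]
  refine Finset.sum_congr rfl fun i _ => Finset.sum_congr rfl fun j _ => ?_
  simp only [Pi.add_apply]
  ring

/-- `X^t Z^z`, with `z` the sum of `t` over the neighbours, stabilizes every prepared state up to a
sign when `t` is supported off the input. -/
lemma prepare_mulVec_add (φ : Reg P.I) (t z : Fin N → ZMod 2) (ht : ∀ i ∈ P.I, t i = 0)
    (hz : ∀ i, z i = open Classical in ∑ j, if P.G.Adj i j then t j else 0)
    (x : Fin N → ZMod 2) :
    (P.prepare *ᵥ φ) (x + t) =
      zsign (P.edgeForm t) * (∏ i, zsign (z i * x i)) * (P.prepare *ᵥ φ) x := by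
  have hx : (fun i : P.I => (x + t) i) = fun i : P.I => x i := by
    funext i; simp [ht i i.2]
  rw [prepare_mulVec, prepare_mulVec, hx, P.edgeForm_add x t ht, zsign_add, zsign_add, zsign_sum]
  simp only [hz, mul_comm (x _)]
  ring

/-- The factors of the product vector that describes the positive branch with output `p`. -/
def targetKet (p : P.O → ZMod 2) (j : Fin N) : ZMod 2 → ℂ :=
  xyKet (P.α j) (if h : j ∈ P.O then p ⟨j, h⟩ else 0)

/-- Moving the stabilizer `X^t Z^z` from the measurement vectors onto the prepared state replaces
the adapted angles by the canonical ones and shifts the outcomes by `z`. -/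
lemma norm_overlap_eq_of_shift (φ : Reg P.I) (t z c : Fin N → ZMod 2)
    (ht : ∀ i ∈ P.I, t i = 0)
    (hz : ∀ i, z i = open Classical in ∑ j, if P.G.Adj i j then t j else 0) :
    ‖overlap (fun j => xyKet (((-1 : ℤ) ^ (t j).val) • (P.α j : Real.Angle)) (c j))
        (P.prepare *ᵥ φ)‖ =
      ‖overlap (fun j => xyKet (P.α j) (c j + z j)) (P.prepare *ᵥ φ)‖ := by
  choose a ha hax using fun j => exists_xyKet_neg (P.α j : Real.Angle) (c j) (t j)
  have h : overlap (fun j => xyKet (((-1 : ℤ) ^ (t j).val) • (P.α j : Real.Angle)) (c j))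
        (P.prepare *ᵥ φ) = (∏ j, star (a j)) * zsign (P.edgeForm t) *
      overlap (fun j => xyKet (P.α j) (c j + z j)) (P.prepare *ᵥ φ) := by
    rw [overlap, overlap, ← Equiv.sum_comp (Equiv.addRight t), Finset.mul_sum]
    refine Finset.sum_congr rfl fun x _ => ?_
    have htt (j : Fin N) : (x + t) j + t j = x j := by
      rw [Pi.add_apply, add_assoc, CharTwo.add_self_eq_zero, add_zero]
    simp only [Equiv.coe_addRight, P.prepare_mulVec_add φ t z ht hz, hax, htt, star_mul',
      Finset.prod_mul_distrib, xyKet_add, star_zsign]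
    ring
  rw [h, norm_mul, norm_mul, norm_zsign, norm_prod]
  simp [ha]

/-! ### Corrections from the g-flow -/

section Flow

variable {P} {prec : Fin N → Fin N → Prop}

lemma sx_eq_zero_of_mem_input (hflow : IsGFlow P.G P.I P.O P.g prec) (b : Fin N → ZMod 2)
    {j : Fin N} (hj : j ∈ P.I) : P.sx b j = 0 := by
  unfold sx
  rw [Finset.filter_false_of_mem, Finset.sum_empty]
  rintro i - ⟨-, hi, hij⟩
  exact hflow.range i hi j hij hj

open Classical in
/-- The `Z` part of the accumulated stabilizers is the sum of all `Z` dependencies. -/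
lemma sum_adj_sx (horder : IsOrderCompatible P.G P.O P.g) (b : Fin N → ZMod 2) (i : Fin N) :
    (∑ j, if P.G.Adj i j then P.sx b j else 0) =
      ∑ k with k ∉ P.O ∧ i ∈ oddNbhd P.G (P.g k), b k := by
  have hsx (j : Fin N) : (if P.G.Adj i j then P.sx b j else 0) =
      ∑ k, if k ∉ P.O then (if j ∈ P.g k ∧ P.G.Adj i j then b k else 0) else 0 := by
    by_cases hadj : P.G.Adj i j
    · rw [if_pos hadj, sx, Finset.sum_filter]
      refine Finset.sum_congr rfl fun k _ => ?_
      by_cases hk : k ∈ P.O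
      · simp [hk]
      · by_cases hj : j ∈ P.g k
        · simp [hk, hj, hadj, horder.x_before k hk j hj]
        · simp [hj]
    · simp [hadj]
  simp only [hsx]
  rw [Finset.sum_comm, Finset.sum_filter]
  refine Finset.sum_congr rfl fun k _ => ?_
  by_cases hk : k ∈ P.O
  · simp [hk]
  · have hcard : (∑ j, if j ∈ P.g k ∧ P.G.Adj i j then b k else 0) =
        (((P.g k).filter fun j => P.G.Adj i j).card : ZMod 2) * b k := by
      rw [← Finset.sum_filter, Finset.sum_const, nsmul_eq_mul]
      congr 3
      ext j; simp
    simp only [hk, not_false_eq_true, if_true, true_and, hcard]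
    by_cases hodd : Odd ((P.g k).filter fun j => P.G.Adj i j).card
    · rw [if_pos (by simpa [oddNbhd] using hodd), (ZMod.natCast_eq_one_iff_odd).2 hodd, one_mul]
    · rw [if_neg (by simpa [oddNbhd] using hodd),
        (ZMod.natCast_eq_zero_iff_even).2 (Nat.not_odd_iff_even.1 hodd), zero_mul]

open Classical in
/-- The stabilizers of the g-flow turn every outcome off the output into `0` (each `b_i` is
cancelled because `i ∈ Odd(g(i))`), and those on the output into the output string. -/
lemma outcome_add_corrections (hflow : IsGFlow P.G P.I P.O P.g prec)
    (horder : IsOrderCompatible P.G P.O P.g) (b : Fin N → ZMod 2) (i : Fin N) :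
    b i + P.sz b i + (∑ k with k ∉ P.O ∧ i ∈ oddNbhd P.G (P.g k), b k) =
      if h : i ∈ P.O then P.output b ⟨i, h⟩ else 0 := by
  split_ifs with hi
  · have h : (∑ k with k ∉ P.O ∧ i ∈ oddNbhd P.G (P.g k), b k) = P.sz b i + P.szOut b i := by
      unfold sz szOut
      rw [← Finset.sum_filter_add_sum_filter_not _ (fun k => P.ZInAngle k i),
        Finset.filter_filter, Finset.filter_filter]
      have hne (k : Fin N) (hk : k ∉ P.O) : k ≠ i := fun h => hk (h ▸ hi)
      congr 2 <;> ext k <;> simp only [Finset.mem_filter, Finset.mem_univ, true_and] <;>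
        have := hne k <;> tauto
    rw [h, output]
    calc _ = b i + P.szOut b i + (P.sz b i + P.sz b i) := by ring
      _ = _ := by rw [CharTwo.add_self_eq_zero, add_zero]
  · have h : (∑ k with k ∉ P.O ∧ i ∈ oddNbhd P.G (P.g k), b k) = b i + P.sz b i := by
      have hmem : i ∈ Finset.univ.filter fun k => k ∉ P.O ∧ i ∈ oddNbhd P.G (P.g k) := by
        simpa [hi] using (hflow.g3 i hi).2
      rw [← Finset.add_sum_erase _ _ hmem, sz]
      congr 2
      ext k
      have hbefore (hk : k ∉ P.O) (hki : k ≠ i) (hodd : i ∈ oddNbhd P.G (P.g k)) : k < i :=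
        horder.z_before k hk i hi hki.symm hodd
      simp only [Finset.mem_erase, Finset.mem_filter, Finset.mem_univ, true_and]
      unfold ZInAngle
      tauto
    rw [h, CharTwo.add_self_eq_zero]

/-- Determinism: the overlap of a branch depends, up to a phase, only on the output. -/
lemma norm_overlap_branchKet (hflow : IsGFlow P.G P.I P.O P.g prec)
    (horder : IsOrderCompatible P.G P.O P.g) (φ : Reg P.I) (b : Fin N → ZMod 2) :
    ‖overlap (P.branchKet b) (P.prepare *ᵥ φ)‖ =
      ‖overlap (P.targetKet (P.output b)) (P.prepare *ᵥ φ)‖ := by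
  classical
  have h := P.norm_overlap_eq_of_shift φ (P.sx b)
    (fun i => ∑ k with k ∉ P.O ∧ i ∈ oddNbhd P.G (P.g k), b k) (fun j => b j + P.sz b j)
    (fun i hi => sx_eq_zero_of_mem_input hflow b hi)
    (fun i => by rw [← sum_adj_sx horder])
  simp only [outcome_add_corrections hflow horder] at h
  exact h

end Flow

/-- The number of outcome strings that lead to the output `0`, and hence to any given output
(`card_output_eq`). -/
def fiberCard : ℕ := (Finset.univ.filter fun b => P.output b = 0).card

lemma fiberCard_ne_zero : P.fiberCard ≠ 0 := by
  rw [fiberCard, Finset.card_ne_zero]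
  refine ⟨0, ?_⟩
  rw [Finset.mem_filter]
  refine ⟨Finset.mem_univ _, ?_⟩
  funext j
  simp [output, szOut]

/-- Flipping the recorded outcomes of output vertices flips the output correspondingly, so all
outputs have equally many outcome strings. -/
lemma card_output_eq (p : P.O → ZMod 2) :
    (Finset.univ.filter fun b => P.output b = p).card = P.fiberCard := by
  let e : Fin N → ZMod 2 := fun i => if h : i ∈ P.O then p ⟨i, h⟩ else 0
  have he (b : Fin N → ZMod 2) : P.output (b + e) = P.output b + p := by
    funext j
    have hs : P.szOut (b + e) j = P.szOut b j := by
      classical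
      refine Finset.sum_congr rfl fun i hi => ?_
      simp [e, (Finset.mem_filter.1 hi).2.1]
    simp only [output, hs, Pi.add_apply]
    simp [e]; ring
  symm
  refine Finset.card_equiv (Equiv.addRight e) fun b => ?_
  simp [he]

/-- The law of the output of the protocol is proportional to the squared overlaps with the positive
branch. -/
lemma outputLaw_prepare_apply {prec : Fin N → Fin N → Prop}
    (hflow : IsGFlow P.G P.I P.O P.g prec) (horder : IsOrderCompatible P.G P.O P.g)
    (φ : Reg P.I) (hφ : sqNorm (P.prepare *ᵥ φ) = 1) (p : P.O → ZMod 2) :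
    P.outputLaw (P.prepare *ᵥ φ) p =
      ENNReal.ofReal (P.fiberCard * ‖overlap (P.targetKet p) (P.prepare *ᵥ φ)‖ ^ 2) := by
  rw [outputLaw_apply _ _ hφ, ← ENNReal.ofReal_sum_of_nonneg fun b _ => by positivity]
  congr 1
  rw [← P.card_output_eq p, ← nsmul_eq_mul, ← Finset.sum_const]
  refine Finset.sum_congr rfl fun b hb => ?_
  rw [norm_overlap_branchKet hflow horder, (Finset.mem_filter.1 hb).2]

end Pattern

/-! ### Isometries and the target computation -/

lemma star_dotProduct_self_eq {n : Type*} [Fintype n] (v : n → ℂ) :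
    star v ⬝ᵥ v = ((∑ i, ‖v i‖ ^ 2 : ℝ) : ℂ) := by
  simp [dotProduct, Complex.conj_mul']

/-- A matrix that scales all norms by the same factor is a multiple of an isometry, by
polarization. -/
lemma smul_conjTranspose_mul_self_eq_one {m n : Type*} [Fintype m] [Fintype n] [DecidableEq n]
    (L : Matrix m n ℂ) (K : ℝ)
    (h : ∀ φ : n → ℂ, K * ∑ y, ‖(L *ᵥ φ) y‖ ^ 2 = ∑ x, ‖φ x‖ ^ 2) :
    (K : ℂ) • (Lᴴ * L) = 1 := by
  have hq (φ : n → ℂ) : star φ ⬝ᵥ (((K : ℂ) • (Lᴴ * L) - 1) *ᵥ φ) = 0 := by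
    rw [Matrix.sub_mulVec, Matrix.one_mulVec, Matrix.smul_mulVec, dotProduct_sub,
      dotProduct_smul, ← Matrix.mulVec_mulVec, Matrix.dotProduct_mulVec, ← Matrix.star_mulVec,
      star_dotProduct_self_eq, star_dotProduct_self_eq, ← h]
    simp
  have hT : Matrix.toEuclideanLin ((K : ℂ) • (Lᴴ * L) - 1) = 0 := by
    rw [← inner_map_self_eq_zero]
    intro x
    rw [← inner_conj_symm, EuclideanSpace.inner_eq_star_dotProduct]
    rw [Matrix.ofLp_toLpLin, Matrix.toLin'_apply, dotProduct_comm, hq, map_zero]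
  rw [← sub_eq_zero]
  exact (Matrix.toEuclideanLin (𝕜 := ℂ) (m := n) (n := n)).injective (by rw [hT, map_zero])

/-- The sum over a register of a function of the qubits in `I`. -/
lemma sum_comp_restrict {V : Type} [Fintype V] [DecidableEq V] (I : Finset V)
    (f : (I → ZMod 2) → ℝ) :
    ∑ x : V → ZMod 2, f (fun i => x i) = 2 ^ Iᶜ.card * ∑ u, f u := by
  rw [← Equiv.sum_comp (Equiv.piEquivPiSubtypeProd (· ∈ I) fun _ : V => ZMod 2).symm,
    Fintype.sum_prod_type]
  have h (u : {i // i ∈ I} → ZMod 2) (w : {i // i ∉ I} → ZMod 2) :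
      (fun i : I => (Equiv.piEquivPiSubtypeProd (· ∈ I) fun _ : V => ZMod 2).symm (u, w) i) =
        u := by
    funext i; simp
  have hc : Fintype.card {i // i ∉ I} = Iᶜ.card := by
    rw [Fintype.card_subtype]; congr 1; ext; simp
  simp only [h, Finset.sum_const, Finset.card_univ, nsmul_eq_mul]
  rw [← Finset.mul_sum, Fintype.card_fun, hc]
  simp [ZMod.card]

lemma norm_one_div_sqrt_two_pow_sq (k : ℕ) :
    ‖((1 / (√2 : ℝ) : ℂ)) ^ k‖ ^ 2 = (2 ^ k)⁻¹ := by
  rw [norm_pow, ← pow_mul, mul_comm, pow_mul]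
  simp

lemma sqNorm_graphState {V : Type} [Fintype V] [LinearOrder V] (G : SimpleGraph V) :
    sqNorm (graphState G) = 1 := by
  have h (x : V → ZMod 2) : ‖graphState G x‖ ^ 2 = (2 ^ Fintype.card V)⁻¹ := by
    simp only [graphState, czSign_eq_zsign]
    rw [norm_mul, mul_pow, norm_one_div_sqrt_two_pow_sq, norm_prod]
    have (i j : V) (p : Prop) [Decidable p] : ‖if p then zsign (x i * x j) else 1‖ = 1 := by
      split_ifs <;> simp [norm_zsign]
    simp [norm_prod, this]
  rw [sqNorm_eq_ofReal]
  simp [h, ZMod.card]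

namespace Pattern

variable {N : ℕ} {A : Set Real.Angle} (P : Pattern N A)

lemma sum_norm_prepare_sq (φ : Reg P.I) :
    ∑ x, ‖(P.prepare *ᵥ φ) x‖ ^ 2 = ∑ u, ‖φ u‖ ^ 2 := by
  simp only [prepare_mulVec, norm_mul, mul_pow, norm_one_div_sqrt_two_pow_sq, norm_zsign]
  rw [sum_comp_restrict P.I fun u => 1 ^ 2 * (2 ^ (P.I)ᶜ.card)⁻¹ * ‖φ u‖ ^ 2, ← Finset.mul_sum]
  field_simp

/-- Preparing the pattern on the graph state of the input gives the graph state of the whole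
graph. -/
lemma prepare_mulVec_graphState :
    P.prepare *ᵥ graphState (P.G.comap (Subtype.val : P.I → Fin N)) = graphState P.G := by
  classical
  funext x
  have hin : (∏ i : P.I, ∏ j : P.I, if i < j ∧ (P.G.comap (Subtype.val : P.I → Fin N)).Adj i j
      then czSign i j (fun i : P.I => x i) else 1) =
      ∏ i, ∏ j, if i < j ∧ P.G.Adj i j ∧ (i ∈ P.I ∧ j ∈ P.I) then czSign i j x else 1 := by
    have h1 (i j : Fin N) : (if i < j ∧ P.G.Adj i j ∧ (i ∈ P.I ∧ j ∈ P.I) then czSign i j x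
        else 1) = if i ∈ P.I then (if j ∈ P.I then
          (if i < j ∧ P.G.Adj i j then czSign i j x else 1) else 1) else 1 := by
      by_cases hi : i ∈ P.I <;> by_cases hj : j ∈ P.I <;> simp [hi, hj]
    have h2 (f : Fin N → ℂ) : ∏ i, (if i ∈ P.I then f i else 1) = ∏ i : P.I, f i := by
      rw [← Finset.prod_filter, Finset.filter_mem_eq_inter, Finset.univ_inter,
        ← Finset.prod_coe_sort]
    have h3 (i : Fin N) (f : Fin N → ℂ) : (∏ j, if i ∈ P.I then f j else 1) =
        if i ∈ P.I then ∏ j, f j else 1 := by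
      split_ifs <;> simp
    simp only [h1, h3, h2]
    rfl
  have hgs : graphState (P.G.comap (Subtype.val : P.I → Fin N)) (fun i => x i) =
      (∏ i, ∏ j, if i < j ∧ P.G.Adj i j ∧ (i ∈ P.I ∧ j ∈ P.I) then czSign i j x else 1) *
        ((1 / (√2 : ℝ) : ℂ)) ^ Fintype.card P.I := by
    rw [← hin, graphState]
    congr!
  rw [prepare_mulVec, hgs, graphState]
  have hsplit : (∏ i, ∏ j, if i < j ∧ P.G.Adj i j then czSign i j x else 1) =
      zsign (P.edgeForm x) *
      ∏ i, ∏ j, if i < j ∧ P.G.Adj i j ∧ (i ∈ P.I ∧ j ∈ P.I) then czSign i j x else 1 := by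
    simp only [edgeForm, zsign_sum, apply_ite zsign, zsign_zero, czSign_eq_zsign,
      ← Finset.prod_mul_distrib]
    refine Finset.prod_congr rfl fun i _ => Finset.prod_congr rfl fun j _ => ?_
    by_cases h : i < j ∧ P.G.Adj i j <;> by_cases h' : i ∈ P.I ∧ j ∈ P.I <;>
      simp only [h, h', and_true, and_false, not_true, not_false_eq_true, if_true,
        if_false, mul_one, one_mul]
  have hcard : (P.I)ᶜ.card + Fintype.card P.I = Fintype.card (Fin N) := by
    rw [Fintype.card_coe, Finset.card_compl_add_card]
  rw [hsplit, ← hcard, pow_add]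
  ring

lemma overlap_targetKet (p : P.O → ZMod 2) (ψ : Reg (Fin N)) :
    overlap (P.targetKet p) ψ = star (P.outKet p) ⬝ᵥ (P.projectPlus *ᵥ ψ) := by
  classical
  have h (x : Fin N → ZMod 2) : ∏ j, star (P.targetKet p j (x j)) =
      star (P.outKet p fun j => x j) * ∏ j ∈ (P.O)ᶜ, star (xyKet (P.α j) 0 (x j)) := by
    rw [← Finset.prod_mul_prod_compl P.O, ← Finset.prod_coe_sort, outKet, star_prod]
    congr 1
    · refine Finset.prod_congr rfl fun j _ => ?_
      simp [targetKet]
    · refine Finset.prod_congr rfl fun j hj => ?_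
      simp [targetKet, Finset.mem_compl.1 hj]
  simp only [overlap, dotProduct, Matrix.mulVec, Finset.mul_sum]
  rw [Finset.sum_comm]
  refine Finset.sum_congr rfl fun x _ => ?_
  rw [Finset.sum_eq_single fun j : P.O => x j]
  · rw [h, projectPlus, if_pos rfl, Pi.star_apply, mul_assoc]
  · intro y _ hy
    rw [projectPlus, if_neg (Ne.symm hy), zero_mul, mul_zero]
  · intro hx
    exact absurd (Finset.mem_univ _) hx

/-- The product vectors `outKet p` are an orthonormal basis of the output register. -/
lemma sum_norm_outKet_dotProduct_sq (η : Reg P.O) :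
    ∑ p, ‖star (P.outKet p) ⬝ᵥ η‖ ^ 2 = ∑ y, ‖η y‖ ^ 2 := by
  refine sum_norm_sum_star_mul_sq P.outKet (fun x y => ?_) η
  simp only [outKet, star_prod, ← Finset.prod_mul_distrib]
  rw [← Fintype.piFinset_univ, ← Finset.prod_univ_sum (fun _ => Finset.univ)
    (fun (j : P.O) b => xyKet (P.α j) b (x j) * star (xyKet (P.α j) b (y j)))]
  simp only [sum_xyKet_mul_star]
  by_cases h : x = y
  · simp [h]
  · obtain ⟨j, hj⟩ := Function.ne_iff.1 h
    rw [if_neg h]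
    exact Finset.prod_eq_zero (Finset.mem_univ j) (if_neg hj)

section Flow

variable {P} {prec : Fin N → Fin N → Prop}

lemma outputLaw_prepare_toReal (hflow : IsGFlow P.G P.I P.O P.g prec)
    (horder : IsOrderCompatible P.G P.O P.g) (φ : Reg P.I) (hφ : ∑ u, ‖φ u‖ ^ 2 = 1)
    (p : P.O → ZMod 2) :
    (P.outputLaw (P.prepare *ᵥ φ) p).toReal =
      P.fiberCard * ‖star (P.outKet p) ⬝ᵥ (P.positiveBranch *ᵥ φ)‖ ^ 2 := by
  have h : sqNorm (P.prepare *ᵥ φ) = 1 := by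
    rw [sqNorm_eq_ofReal, sum_norm_prepare_sq, hφ, ENNReal.ofReal_one]
  rw [outputLaw_prepare_apply P hflow horder φ h, ENNReal.toReal_ofReal (by positivity),
    overlap_targetKet, positiveBranch, Matrix.mulVec_mulVec]

/-- The positive branch is a multiple of an isometry: the probabilities of the protocol run on any
input sum to `1`. -/
lemma fiberCard_smul_positiveBranch (hflow : IsGFlow P.G P.I P.O P.g prec)
    (horder : IsOrderCompatible P.G P.O P.g) :
    ((P.fiberCard : ℝ) : ℂ) • (P.positiveBranchᴴ * P.positiveBranch) = 1 := by
  have hunit (φ : Reg P.I) (hφ : ∑ u, ‖φ u‖ ^ 2 = 1) :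
      (P.fiberCard : ℝ) * ∑ y, ‖(P.positiveBranch *ᵥ φ) y‖ ^ 2 = 1 := by
    have hsum := (P.outputLaw (P.prepare *ᵥ φ)).tsum_coe
    rw [tsum_fintype] at hsum
    rw [← sum_norm_outKet_dotProduct_sq, Finset.mul_sum]
    simp only [← outputLaw_prepare_toReal hflow horder φ hφ]
    rw [← ENNReal.toReal_sum fun p _ => PMF.apply_ne_top _ p, hsum, ENNReal.toReal_one]
  refine smul_conjTranspose_mul_self_eq_one _ _ fun φ => ?_
  by_cases h0 : ∑ u, ‖φ u‖ ^ 2 = 0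
  · have : φ = 0 := by
      funext u
      simpa using (Finset.sum_eq_zero_iff_of_nonneg fun u _ => by positivity).1 h0 u
        (Finset.mem_univ u)
    simp [this]
  · have hpos : 0 < ∑ u, ‖φ u‖ ^ 2 :=
      lt_of_le_of_ne (Finset.sum_nonneg fun u _ => by positivity) (Ne.symm h0)
    set s := ∑ u, ‖φ u‖ ^ 2 with hs
    have hc : ‖((√s : ℝ) : ℂ)⁻¹‖ ^ 2 = s⁻¹ := by
      rw [norm_inv, inv_pow, Complex.norm_real, Real.norm_eq_abs, sq_abs, Real.sq_sqrt hpos.le]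
    have h := hunit (((√s : ℝ) : ℂ)⁻¹ • φ) (by
      simp only [Pi.smul_apply, norm_smul, mul_pow, hc, ← Finset.mul_sum, ← hs]
      exact inv_mul_cancel₀ h0)
    simp only [Matrix.mulVec_smul, Pi.smul_apply, norm_smul, mul_pow, hc, ← Finset.mul_sum] at h
    field_simp at h
    exact h

lemma exists_implements (hflow : IsGFlow P.G P.I P.O P.g prec)
    (horder : IsOrderCompatible P.G P.O P.g) :
    ∃ Δ : Computation P.I P.O, P.Implements Δ := by
  have hK : (0 : ℝ) < P.fiberCard := Nat.cast_pos.2 (Nat.pos_of_ne_zero P.fiberCard_ne_zero)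
  have hs : ((√(P.fiberCard : ℝ) : ℝ) : ℂ) ≠ 0 := by
    simpa using (Real.sqrt_pos.2 hK).ne'
  refine ⟨⟨_, ((√(P.fiberCard : ℝ) : ℝ) : ℂ) • P.positiveBranch, _⟩, rfl, ?_,
    ⟨_, inv_ne_zero hs, ?_⟩, fun p => rfl⟩
  · have h := fiberCard_smul_positiveBranch hflow horder
    have hsq : ((√(P.fiberCard : ℝ) : ℝ) : ℂ) * ((√(P.fiberCard : ℝ) : ℝ) : ℂ) =
        ((P.fiberCard : ℝ) : ℂ) := by
      rw [← Complex.ofReal_mul, Real.mul_self_sqrt hK.le]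
    simp only [Matrix.conjTranspose_smul, Matrix.smul_mul, Matrix.mul_smul, smul_smul]
    rw [Complex.star_def, Complex.conj_ofReal, hsq]
    convert h
  · simp only [smul_smul, inv_mul_cancel₀ hs, one_smul]

end Flow

lemma Implements.prob_eq {P : Pattern N A} {Δ : Computation P.I P.O} (h : P.Implements Δ)
    (p : P.O → ZMod 2) :
    Δ.prob p = ((‖star (P.outKet p) ⬝ᵥ
      (Δ.U *ᵥ graphState (P.G.comap (Subtype.val : P.I → Fin N)))‖ ^ 2 : ℝ) : ℂ) := by
  set γ := graphState (P.G.comap (Subtype.val : P.I → Fin N)) with hγ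
  have hU : Δ.U * Δ.ρ * Δ.Uᴴ = Matrix.vecMulVec (Δ.U *ᵥ γ) (star (Δ.U *ᵥ γ)) := by
    rw [h.input, Matrix.mul_vecMulVec, Matrix.vecMulVec_mul, Matrix.star_mulVec]
  have hp : Δ.prob p = (Δ.M p * (Δ.U * Δ.ρ * Δ.Uᴴ)).trace := by
    unfold Computation.prob
    congr!
  rw [hp, hU, h.measurement, Matrix.vecMulVec_mul_vecMulVec, Matrix.trace_vecMulVec,
    dotProduct_smul, Complex.ofReal_pow, ← Complex.mul_conj', smul_eq_mul]
  congr 1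
  change _ = star _
  rw [Matrix.star_dotProduct, star_star, dotProduct_comm]

end Pattern

end CDBQC

end

/-- Correctness of classically driven blind quantum computing: if the pattern has a g-flow and is
compatible with the measurement order, then it implements a target computation, and for every
target computation that it implements, the output string of the protocol with honest Alice and Bob
has exactly the law of the outcome of the final measurement on `U ρ U†`. -/
theorem theorem1 {N : ℕ} (A : Set Real.Angle) (hA : CDBQC.IsAngleDomain A)
    (P : CDBQC.Pattern N A) (prec : Fin N → Fin N → Prop)
    (hflow : CDBQC.IsGFlow P.G P.I P.O P.g prec)
    (horder : CDBQC.IsOrderCompatible P.G P.O P.g) :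
    (∃ Δ : CDBQC.Computation P.I P.O, P.Implements Δ) ∧
      ∀ Δ : CDBQC.Computation P.I P.O, P.Implements Δ →
        ∀ p : P.O → ZMod 2, ((P.honestOutput p).toReal : ℂ) = Δ.prob p := by
  refine ⟨CDBQC.Pattern.exists_implements hflow horder, fun Δ hΔ p => ?_⟩
  obtain ⟨c, -, hc⟩ := hΔ.branch
  set γ := CDBQC.graphState (P.G.comap (Subtype.val : P.I → Fin N)) with hγ
  have hnorm : ∑ u, ‖γ u‖ ^ 2 = 1 := by
    have := CDBQC.sqNorm_graphState (P.G.comap (Subtype.val : P.I → Fin N))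
    rwa [CDBQC.sqNorm_eq_ofReal, ENNReal.ofReal_eq_one] at this
  -- The isometry condition on `U` fixes the modulus of the scalar between `U` and the branch.
  have hscale : (P.fiberCard : ℝ) * ‖c‖ ^ 2 = 1 := by
    have h := CDBQC.Pattern.fiberCard_smul_positiveBranch hflow horder
    have hU : Δ.Uᴴ * Δ.U = 1 := by convert hΔ.isometry
    rw [hc] at h
    simp only [Matrix.conjTranspose_smul, Matrix.smul_mul, Matrix.mul_smul, smul_smul, hU] at h
    have h0 := congrFun (congrFun h 0) 0
    simp only [Matrix.smul_apply, Matrix.one_apply_eq, smul_eq_mul, mul_one, Complex.star_def,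
      Complex.mul_conj'] at h0
    exact_mod_cast h0
  have hlaw : P.honestOutput = P.outputLaw (P.prepare *ᵥ γ) := by
    rw [CDBQC.Pattern.prepare_mulVec_graphState]; rfl
  rw [hlaw, CDBQC.Pattern.outputLaw_prepare_toReal hflow horder γ hnorm, hΔ.prob_eq, ← hγ, hc,
    Matrix.smul_mulVec, dotProduct_smul, norm_smul, mul_pow, ← mul_assoc, hscale, one_mul]
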